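/- For $x,y\in\mathbb R$ let $x\sim y=(x+y+1)/2$. Let $\mathcal F\subset\mathbb R$ be the set of fusible numbers, that is, the smallest set such that $0\in\mathcal F$, and $x\sim y\in\mathcal F$ whenever $x,y\in\mathcal F$ and $|y-x|<1$. Then $\mathcal F$, ordered by the usual order $<$ on $\mathbb R$, is well-ordered, and its order type is exactly $\varepsilon_0$, the limit of the ordinals $\omega,\ \omega^{\omega},\ \omega^{\omega^{\omega}},\dots$ (equivalently, the least ordinal $\alpha$ with $\omega^\alpha=\alpha$). -/

import Mathlib

open scoped Ordinal

/-- The operation `x ∼ y = (x + y + 1) / 2` on the reals ("`x` fuse `y`"). -/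
noncomputable def fuse (x y : ℝ) : ℝ := (x + y + 1) / 2

/-- The fusible numbers: `0` is fusible, and `x ∼ y` is fusible whenever `x` and `y` are fusible
and `|y - x| < 1`; nothing else is. -/
inductive IsFusible : ℝ → Prop
  | zero : IsFusible 0
  | fuse {x y : ℝ} (hx : IsFusible x) (hy : IsFusible y) (hxy : |y - x| < 1) :
      IsFusible (fuse x y)

/-- The set `F` of fusible numbers. -/
def fusibleNumbers : Set ℝ := {x | IsFusible x}

/-!
Write `F` for the set of fusible numbers and `o x` for the order type of `F ∩ (-∞, x)`.

*Well-ordering.* If `F ∩ (-∞, z)` is well-ordered, then it has a least element `u₀ > z - 1` (or none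
there). A fused number `u ∼ v` with `u ≤ v` and `z ≤ v` has `u > z - 1`, and `u < z` if it is close
to `z`; hence `u ≥ u₀`, and `u ∼ v` exceeds `z` by at least `(u₀ + 1 - z) / 2`. So slightly above
`z` every fusible number is fused from numbers below `z`, and `F ∩ (-∞, z + δ)` is contained in the
union of `F ∩ (-∞, z)`, `{0}` and a monotone image of a product of two well-ordered sets. The
supremum of the good `z` is itself good, hence it does not exist (`isPWO_fusibleNumbers`).

*Upper bound.* By induction on `x`, `o (x + 1) ≤ ω ^ ω ^ (o x + 1)`
(`typeLT_Iio_fusibleAddOne_le`). Put `B k = F ∩ (-∞, x + 1 - 2⁻ᵏ)`. If `u ∼ v`, with `u ≤ v`, lies in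
`B (k + 1)`, then either `u < x`, and `u ∼ v < u + 1` is covered by the induction hypothesis, or
`x ≤ u`, and then `u` and `v` both lie in `B k`. So it is enough that the sets of order type below
`ω ^ ω ^ g` are closed under unions and under monotone images of products
(`typeLT_union_lt_opow`, `typeLT_relImage_lt`), which is a matter of natural sums of ordinals.
Consequently `o n < ε₀` for all natural numbers `n`.

*Lower bound.* By induction on `x`, every interval `[t, x + 1)` with `t < x + 1` contains a set of
fusible numbers of order type at least `ω ^ o x` (`opow_le_typeLT_Ico`): if `y ∈ F` and
`x - 1 < y < x`, then `s ↦ x ∼ s` contracts towards `x + 1`, and its iterates carry `F ∩ [x, y + 1)`,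
which has type at least `ω ^ o y`, into `F`, arbitrarily close to `x + 1`. So infinitely many
successive copies fit below `x + 1`. Hence `ω ^ o x ≤ o (x + 1)`, the order type `θ` of `F` satisfies
`ω ^ θ ≤ θ`, and `ε₀ ≤ θ`.
-/

/-! ### Natural sums of ordinals -/

section NaturalSum

open Ordinal Set Order

universe u

/-- The natural (Hessenberg) sum of two ordinals, defined as the least operation that is strictly
increasing in both arguments. -/
noncomputable def hsum (a b : Ordinal.{u}) : Ordinal.{u} :=
  max (⨆ x : Iio a, succ (hsum x.1 b)) (⨆ y : Iio b, succ (hsum a y.1))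
termination_by (a, b)
decreasing_by
  · exact Prod.Lex.left _ _ x.2
  · exact Prod.Lex.right _ y.2

theorem hsum_le_iff {a b c : Ordinal.{u}} :
    hsum a b ≤ c ↔ (∀ a' < a, hsum a' b < c) ∧ ∀ b' < b, hsum a b' < c := by
  rw [hsum]
  simp [Ordinal.iSup_le_iff]

theorem hsum_lt_hsum_right {a a' : Ordinal.{u}} (h : a' < a) (b : Ordinal.{u}) :
    hsum a' b < hsum a b :=
  (hsum_le_iff.1 le_rfl).1 a' h

theorem hsum_lt_hsum_left {b b' : Ordinal.{u}} (h : b' < b) (a : Ordinal.{u}) :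
    hsum a b' < hsum a b :=
  (hsum_le_iff.1 le_rfl).2 b' h

theorem hsum_mono {a a' b b' : Ordinal.{u}} (ha : a' ≤ a) (hb : b' ≤ b) :
    hsum a' b' ≤ hsum a b := by
  have h1 : hsum a' b' ≤ hsum a b' := by
    rcases ha.eq_or_lt with rfl | h
    · rfl
    · exact (hsum_lt_hsum_right h _).le
  have h2 : hsum a b' ≤ hsum a b := by
    rcases hb.eq_or_lt with rfl | h
    · rfl
    · exact (hsum_lt_hsum_left h _).le
  exact h1.trans h2

/-- An ordinal below `ω ^ e * n + x` has the form `ω ^ e * m + y`, where `(m, y)` precedes `(n, x)`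
lexicographically. -/
theorem exists_natCast_mul_add {e a x : Ordinal.{u}} {n : ℕ} (h : a < ω ^ e * n + x)
    (hx : x < ω ^ e) :
    ∃ (m : ℕ) (y : Ordinal.{u}), a = ω ^ e * m + y ∧ y < ω ^ e ∧ (m < n ∨ m = n ∧ y < x) := by
  have hpos : (ω ^ e : Ordinal.{u}) ≠ 0 := (opow_pos _ omega0_pos).ne'
  have hdiv : a / ω ^ e < (n + 1 : ℕ) := by
    rw [← lt_mul_iff_div_lt hpos]
    refine h.trans ?_
    push_cast
    rw [mul_add_one]
    gcongr
  obtain ⟨m, hm⟩ := lt_omega0.1 (hdiv.trans (natCast_lt_omega0 _))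
  have ha : a = ω ^ e * m + a % ω ^ e := by rw [← hm, div_add_mod]
  have hmn : m ≤ n := by
    rw [hm] at hdiv
    exact Nat.lt_succ_iff.1 (by exact_mod_cast hdiv)
  refine ⟨m, a % ω ^ e, ha, mod_lt _ hpos, ?_⟩
  rcases hmn.lt_or_eq with h' | rfl
  · exact Or.inl h'
  · refine Or.inr ⟨rfl, ?_⟩
    rw [ha] at h
    exact lt_of_add_lt_add_left h

/-- If `ω ^ e` is closed under natural sums, then the natural sum of two ordinals below
`ω ^ (e + 1)` adds the coefficients of `ω ^ e`. -/
theorem hsum_opow_mul_add_le {e : Ordinal.{u}}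
    (he : ∀ x < ω ^ e, ∀ y < ω ^ e, hsum x y < ω ^ e) (a b : Ordinal.{u}) :
    ∀ (n m : ℕ) (x y : Ordinal.{u}), x < ω ^ e → y < ω ^ e → a = ω ^ e * n + x →
      b = ω ^ e * m + y → hsum a b ≤ ω ^ e * (n + m : ℕ) + hsum x y := by
  have key : ∀ (k l : ℕ) (x : Ordinal.{u}), k < l → x < ω ^ e →
      ω ^ e * k + x < ω ^ e * l := by
    intro k l x hkl hx
    calc ω ^ e * k + x < ω ^ e * k + ω ^ e := by gcongr
      _ = ω ^ e * (k + 1 : ℕ) := by push_cast; rw [mul_add_one]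
      _ ≤ ω ^ e * l := by gcongr; exact hkl
  intro n m x y hx hy ha hb
  rw [hsum_le_iff]
  constructor
  · intro a' ha'
    obtain ⟨k, z, hz, hze, hcase⟩ := exists_natCast_mul_add (ha ▸ ha') hx
    have ih := hsum_opow_mul_add_le he a' b k m z y hze hy hz hb
    refine ih.trans_lt ?_
    rcases hcase with hk | ⟨rfl, hzx⟩
    · exact (key _ _ _ (by omega) (he _ hze _ hy)).trans_le le_self_add
    · gcongr
      exact hsum_lt_hsum_right hzx _
  · intro b' hb'
    obtain ⟨k, z, hz, hze, hcase⟩ := exists_natCast_mul_add (hb ▸ hb') hy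
    have ih := hsum_opow_mul_add_le he a b' n k x z hx hze ha hz
    refine ih.trans_lt ?_
    rcases hcase with hk | ⟨rfl, hzx⟩
    · exact (key _ _ _ (by omega) (he _ hx _ hze)).trans_le le_self_add
    · gcongr
      exact hsum_lt_hsum_left hzx _
termination_by (a, b)

theorem isPrincipal_hsum_omega0_opow (e : Ordinal.{u}) : IsPrincipal hsum (ω ^ e) := by
  induction e using WellFoundedLT.induction with
  | _ e ih =>
  intro a b ha hb
  rcases eq_or_ne e 0 with rfl | he
  · rw [opow_zero, Order.lt_one_iff] at ha hb ⊢
    subst ha hb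
    rw [← nonpos_iff_eq_zero, hsum_le_iff]
    simp
  · obtain ⟨c, hc, n, hn⟩ := (lt_omega0_opow he).1 (max_lt ha hb)
    have hpos : (0 : Ordinal.{u}) < ω ^ c := opow_pos _ omega0_pos
    have h0 : hsum (ω ^ c * n) (ω ^ c * n) ≤ ω ^ c * (n + n : ℕ) + hsum 0 0 :=
      hsum_opow_mul_add_le (fun x hx y hy => ih c hc hx hy) _ _ n n 0 0 hpos hpos
        (by simp) (by simp)
    have h00 : hsum (0 : Ordinal.{u}) 0 = 0 := by
      rw [← nonpos_iff_eq_zero, hsum_le_iff]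
      simp
    rw [h00, add_zero] at h0
    calc hsum a b ≤ hsum (ω ^ c * n) (ω ^ c * n) :=
          hsum_mono ((le_max_left _ _).trans hn.le) ((le_max_right _ _).trans hn.le)
      _ ≤ ω ^ c * (n + n : ℕ) := h0
      _ < ω ^ e := opow_mul_lt_opow (natCast_lt_omega0 _) hc

end NaturalSum

/-! ### Order types of subsets of a well-order -/
section OrderType

open Ordinal Set Order

universe u

variable {α : Type u} [LinearOrder α] [WellFoundedLT α] {s t : Set α}

theorem typeLT_le_of_strictMonoOn {β : Type u} [LinearOrder β] [WellFoundedLT β] {t : Set β}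
    (f : α → β) (hf : StrictMonoOn f s) (h : MapsTo f s t) : typeLT s ≤ typeLT t :=
  RelEmbedding.ordinal_type_le
    (OrderEmbedding.ofStrictMono (h.restrict f s t) fun x y hxy => hf x.2 y.2 hxy).ltEmbedding

theorem typeLT_inter_Iio {x : α} (hx : x ∈ s) :
    typeLT ↥(s ∩ Iio x) = typein (α := s) (· < ·) ⟨x, hx⟩ := by
  rw [← type_Iio_lt]
  refine RelIso.ordinalType_congr ⟨⟨fun y => ⟨⟨y.1, y.2.1⟩, y.2.2⟩, fun y => ⟨y.1.1, y.1.2, y.2⟩,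
    fun _ => rfl, fun _ => rfl⟩, Iff.rfl⟩

theorem typeLT_inter_Iio_lt {x : α} (hx : x ∈ s) : typeLT ↥(s ∩ Iio x) < typeLT s := by
  rw [typeLT_inter_Iio hx]
  exact typein_lt_type _ _

theorem exists_typeLT_inter_Iio_eq {o : Ordinal.{u}} (h : o < typeLT s) :
    ∃ x ∈ s, typeLT ↥(s ∩ Iio x) = o := by
  obtain ⟨x, hx⟩ := typein_surj (α := s) (· < ·) h
  exact ⟨x, x.2, by rw [typeLT_inter_Iio x.2, hx]⟩

theorem typeLT_le_of_forall_lt {o : Ordinal.{u}} (h : ∀ x ∈ s, typeLT ↥(s ∩ Iio x) < o) :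
    typeLT s ≤ o := by
  by_contra! hlt
  obtain ⟨x, hx, hxo⟩ := exists_typeLT_inter_Iio_eq hlt
  exact (h x hx).ne hxo

theorem typeLT_union_of_lt (h : ∀ x ∈ s, ∀ y ∈ t, x < y) :
    typeLT ↥(s ∪ t) = typeLT s + typeLT t := by
  rw [← type_sum_lex]
  refine (RelIso.ordinalType_congr (RelIso.ofSurjective (RelEmbedding.ofMonotone
    (Sum.elim (fun x => (⟨x.1, Or.inl x.2⟩ : ↥(s ∪ t))) fun y => ⟨y.1, Or.inr y.2⟩) ?_) ?_)).symm
  · rintro (⟨x, hx⟩ | ⟨x, hx⟩) (⟨y, hy⟩ | ⟨y, hy⟩) hxy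
    · have hxy' : x < y := by simpa using hxy
      exact hxy'
    · exact h x hx y hy
    · simp at hxy
    · have hxy' : x < y := by simpa using hxy
      exact hxy'
  · rintro ⟨x, hx | hx⟩
    · exact ⟨Sum.inl ⟨x, hx⟩, rfl⟩
    · exact ⟨Sum.inr ⟨x, hx⟩, rfl⟩

/-- However two sets interleave, the order type of their union is at most the natural sum of their
order types. -/
theorem typeLT_union_le_hsum (s t : Set α) :
    typeLT ↥(s ∪ t) ≤ hsum (typeLT s) (typeLT t) := by
  have key : ∀ x, typeLT ↥((s ∪ t) ∩ Iio x) ≤ hsum (typeLT ↥(s ∩ Iio x)) (typeLT ↥(t ∩ Iio x)) := by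
    intro x
    induction x using WellFoundedLT.induction with
    | _ x ih =>
    refine typeLT_le_of_forall_lt fun y ⟨hy, hyx⟩ => ?_
    have hle : ∀ r : Set α, r ∩ Iio y ⊆ r ∩ Iio x :=
      fun r => inter_subset_inter_right r (Iio_subset_Iio (le_of_lt hyx))
    have hlt : ∀ r : Set α, y ∈ r → typeLT ↥(r ∩ Iio y) < typeLT ↥(r ∩ Iio x) := by
      intro r hr
      refine (type_mono ?_).trans_lt (typeLT_inter_Iio_lt (s := r ∩ Iio x) ⟨hr, hyx⟩)
      exact fun z hz => ⟨hle r hz, hz.2⟩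
    refine (type_mono ?_).trans_lt ((ih y hyx).trans_lt ?_)
    · exact fun z hz => ⟨hz.1.1, hz.2⟩
    rcases hy with hy | hy
    · exact (hsum_lt_hsum_right (hlt s hy) _).trans_le (hsum_mono le_rfl (type_mono (hle t)))
    · exact (hsum_lt_hsum_left (hlt t hy) _).trans_le (hsum_mono (type_mono (hle s)) le_rfl)
  refine typeLT_le_of_forall_lt fun y hy => (key y).trans_lt ?_
  rcases hy with hy | hy
  · exact (hsum_lt_hsum_right (typeLT_inter_Iio_lt hy) _).trans_le
      (hsum_mono le_rfl (type_mono inter_subset_left))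
  · exact (hsum_lt_hsum_left (typeLT_inter_Iio_lt hy) _).trans_le
      (hsum_mono (type_mono inter_subset_left) le_rfl)

theorem typeLT_union_lt_opow {e : Ordinal.{u}} (hs : typeLT s < ω ^ e) (ht : typeLT t < ω ^ e) :
    typeLT ↥(s ∪ t) < ω ^ e :=
  (typeLT_union_le_hsum s t).trans_lt (isPrincipal_hsum_omega0_opow e hs ht)

/-- A set of order type less than `ω ^ e` is a finite union of sets whose order types are at most
`ω ^ c` with `c < e`, so a property that is stable under unions passes from the latter to the
former. -/
theorem typeLT_induction_lt_opow {p : Set α → Prop} {e : Ordinal.{u}} (empty : p ∅)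
    (union : ∀ s t, p s → p t → p (s ∪ t))
    (piece : ∀ c < e, ∀ s : Set α, typeLT s ≤ ω ^ c → p s) (hs : typeLT s < ω ^ e) : p s := by
  rcases eq_or_ne e 0 with rfl | he
  · rw [opow_zero, Order.lt_one_iff, type_eq_zero_iff_isEmpty, isEmpty_coe_sort] at hs
    exact hs ▸ empty
  obtain ⟨c, hc, n, hn⟩ := (lt_omega0_opow he).1 hs
  clear hs
  replace hn := hn.le
  induction n generalizing s with
  | zero =>
    rw [Nat.cast_zero, mul_zero, nonpos_iff_eq_zero, type_eq_zero_iff_isEmpty,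
      isEmpty_coe_sort] at hn
    exact hn ▸ empty
  | succ n ih =>
    rcases le_or_gt (typeLT s) (ω ^ c * n) with h | h
    · exact ih h
    obtain ⟨x, -, hx⟩ := exists_typeLT_inter_Iio_eq h
    have hs : s = s ∩ Iio x ∪ s ∩ Ici x := by
      rw [← inter_union_distrib_left, Iio_union_Ici, inter_univ]
    rw [hs]
    refine union _ _ (ih hx.le) (piece c hc _ ?_)
    rw [hs, typeLT_union_of_lt fun y hy z hz => lt_of_lt_of_le hy.2 hz.2, hx, Nat.cast_succ,
      mul_add_one] at hn
    exact le_of_add_le_add_left hn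

/-- The image of `s × t` under a partial operation, given by its graph `R`. -/
def relImage (R : α → α → α → Prop) (s t : Set α) : Set α :=
  {z | ∃ x ∈ s, ∃ y ∈ t, R x y z}

/-- A monotone image of `s × t` has order type at most `ω ^ (a ⊕ b)` if `s` and `t` have order types
at most `ω ^ a` and `ω ^ b`. Elements below the value at `(x, y)` have their first argument below `x`
or their second below `y`; the sets of such arguments split into finitely many pieces of smaller
exponent. -/
theorem typeLT_relImage_le {R : α → α → α → Prop}
    (hR : ∀ x y z x' y' z', R x y z → R x' y' z' → x ≤ x' → y ≤ y' → z ≤ z')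
    (a b : Ordinal.{u}) (s t : Set α) (hs : typeLT s ≤ ω ^ a) (ht : typeLT t ≤ ω ^ b) :
    typeLT (relImage R s t) ≤ ω ^ hsum a b := by
  have hempty : typeLT (∅ : Set α) < ω ^ hsum a b := by
    rw [type_eq_zero_of_empty]
    exact opow_pos _ omega0_pos
  refine typeLT_le_of_forall_lt ?_
  rintro z ⟨x, hx, y, hy, hz⟩
  have hsub : relImage R s t ∩ Iio z ⊆
      relImage R (s ∩ Iio x) t ∪ relImage R s (t ∩ Iio y) := by
    rintro w ⟨⟨x', hx', y', hy', hw⟩, hwz⟩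
    by_cases hxx : x' < x
    · exact Or.inl ⟨x', ⟨hx', hxx⟩, y', hy', hw⟩
    by_cases hyy : y' < y
    · exact Or.inr ⟨x', hx', y', ⟨hy', hyy⟩, hw⟩
    exact absurd (hR _ _ _ _ _ _ hz hw (not_lt.1 hxx) (not_lt.1 hyy)) (not_le.2 hwz)
  refine (type_mono hsub).trans_lt (typeLT_union_lt_opow ?_ ?_)
  · refine typeLT_induction_lt_opow (p := fun r => typeLT (relImage R r t) < ω ^ hsum a b)
      ?_ ?_ ?_ ((typeLT_inter_Iio_lt hx).trans_le hs)
    · convert hempty <;> simp [relImage]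
    · intro r r' hr hr'
      refine (type_mono ?_).trans_lt (typeLT_union_lt_opow hr hr')
      rintro w ⟨x', hx' | hx', h⟩
      · exact Or.inl ⟨x', hx', h⟩
      · exact Or.inr ⟨x', hx', h⟩
    · intro c hc r hr
      refine (typeLT_relImage_le hR c b r t hr ht).trans_lt ?_
      exact (opow_lt_opow_iff_right one_lt_omega0).2 (hsum_lt_hsum_right hc b)
  · refine typeLT_induction_lt_opow (p := fun r => typeLT (relImage R s r) < ω ^ hsum a b)
      ?_ ?_ ?_ ((typeLT_inter_Iio_lt hy).trans_le ht)
    · convert hempty <;> simp [relImage]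
    · intro r r' hr hr'
      refine (type_mono ?_).trans_lt (typeLT_union_lt_opow hr hr')
      rintro w ⟨x', hx', y', hy' | hy', h⟩
      · exact Or.inl ⟨x', hx', y', hy', h⟩
      · exact Or.inr ⟨x', hx', y', hy', h⟩
    · intro c hc r hr
      refine (typeLT_relImage_le hR a c s r hs hr).trans_lt ?_
      exact (opow_lt_opow_iff_right one_lt_omega0).2 (hsum_lt_hsum_left hc a)
termination_by (a, b)

theorem typeLT_relImage_lt {R : α → α → α → Prop}
    (hR : ∀ x y z x' y' z', R x y z → R x' y' z' → x ≤ x' → y ≤ y' → z ≤ z')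
    {g : Ordinal.{u}} (hg : g ≠ 0) (hs : typeLT s < ω ^ ω ^ g) (ht : typeLT t < ω ^ ω ^ g) :
    typeLT (relImage R s t) < ω ^ ω ^ g := by
  have key : ∀ o : Ordinal.{u}, o < ω ^ ω ^ g → ∃ a < ω ^ g, o ≤ ω ^ a := by
    intro o ho
    rw [lt_opow_of_isSuccLimit omega0_ne_zero
      (isSuccLimit_opow_left isSuccLimit_omega0 hg)] at ho
    obtain ⟨a, ha, h⟩ := ho
    exact ⟨a, ha, h.le⟩
  obtain ⟨a, ha, hsa⟩ := key _ hs
  obtain ⟨b, hb, htb⟩ := key _ ht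
  exact (typeLT_relImage_le hR a b s t hsa htb).trans_lt
    ((opow_lt_opow_iff_right one_lt_omega0).2 (isPrincipal_hsum_omega0_opow g ha hb))

end OrderType

/-! ### Fusible numbers are well-ordered -/
section Fusible

open Ordinal Set Order

theorem IsFusible.nonneg {x : ℝ} (h : IsFusible x) : 0 ≤ x := by
  induction h with
  | zero => exact le_rfl
  | fuse _ _ _ hx hy => unfold _root_.fuse; linarith

theorem IsFusible.add_one {x : ℝ} (h : IsFusible x) : IsFusible (x + 1) := by
  induction h with
  | zero =>
    have h2 : IsFusible (_root_.fuse 0 0) := .fuse .zero .zero (by norm_num)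
    have h1 : IsFusible (_root_.fuse (_root_.fuse 0 0) (_root_.fuse 0 0)) := .fuse h2 h2 (by norm_num)
    convert h1 using 1
    norm_num [_root_.fuse]
  | @fuse x y _ _ hxy hx hy =>
    have := IsFusible.fuse hx hy (by simpa using hxy)
    convert this using 1
    unfold _root_.fuse
    ring

/-- A nonzero fusible number is fused from `x ≤ y` with `y < x + 1`, as `∼` is symmetric. -/
theorem IsFusible.eq_zero_or_exists_le {z : ℝ} (h : IsFusible z) :
    z = 0 ∨ ∃ x y, IsFusible x ∧ IsFusible y ∧ x ≤ y ∧ y < x + 1 ∧ z = _root_.fuse x y := by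
  cases h with
  | zero => exact Or.inl rfl
  | @fuse x y hx hy hxy =>
    rw [abs_lt] at hxy
    rcases le_total x y with h | h
    · exact Or.inr ⟨x, y, hx, hy, h, by linarith, rfl⟩
    · exact Or.inr ⟨y, x, hy, hx, h, by linarith, by unfold _root_.fuse; ring⟩

theorem isPWO_image2_fuse {s t : Set ℝ} (hs : s.IsPWO) (ht : t.IsPWO) :
    (image2 fuse s t).IsPWO := by
  rw [← image_prod]
  refine (hs.prod ht).image_of_monotone fun p q hpq => ?_
  have h1 := hpq.1
  have h2 := hpq.2
  simp only [fuse]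
  linarith

theorem isPWO_fusibleNumbers_inter_Iio_of_forall_lt {z : ℝ}
    (h : ∀ r < z, (fusibleNumbers ∩ Iio r).IsPWO) : (fusibleNumbers ∩ Iio z).IsPWO := by
  rw [isPWO_iff_isWF, isWF_iff_no_descending_seq]
  intro f hf hmem
  have hIio : (fusibleNumbers ∩ Iio (f 0)).IsWF := (h _ (hmem 0).2).isWF
  rw [isWF_iff_no_descending_seq] at hIio
  refine hIio (fun n => f (n + 1)) (fun m n hmn => hf (by omega)) fun n => ⟨(hmem _).1, ?_⟩
  exact hf (Nat.succ_pos n)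

/-- Well-ordering of the fusible numbers below `z` extends a little beyond `z`. -/
theorem exists_isPWO_fusibleNumbers_inter_Iio_add {z : ℝ} (h : (fusibleNumbers ∩ Iio z).IsPWO) :
    ∃ δ > 0, (fusibleNumbers ∩ Iio (z + δ)).IsPWO := by
  -- `u₀` is the least fusible number in `(z - 1, z)`, and `z` if there is none.
  obtain ⟨u₀, hu₀, hmin⟩ : ∃ u₀ > z - 1, ∀ u ∈ fusibleNumbers ∩ Iio z, z - 1 < u → u₀ ≤ u := by
    rcases (fusibleNumbers ∩ Iio z ∩ Ioi (z - 1)).eq_empty_or_nonempty with he | hne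
    · refine ⟨z, by linarith, fun u hu hzu => ?_⟩
      have : u ∈ fusibleNumbers ∩ Iio z ∩ Ioi (z - 1) := ⟨hu, hzu⟩
      simp [he] at this
    · have hwf := (h.mono (inter_subset_left (t := Ioi (z - 1)))).isWF
      exact ⟨hwf.min hne, (hwf.min_mem hne).2, fun u hu hzu => hwf.min_le hne ⟨hu, hzu⟩⟩
  refine ⟨min ((u₀ + 1 - z) / 2) (1 / 2), lt_min (by linarith) (by norm_num),
    (((isPWO_image2_fuse h h).union h).insert 0).mono ?_⟩
  rintro s ⟨hs, hsz⟩
  have h1 : s < z + (u₀ + 1 - z) / 2 := lt_of_lt_of_le hsz (by gcongr; exact min_le_left _ _)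
  have h2 : s < z + 1 / 2 := lt_of_lt_of_le hsz (by gcongr; exact min_le_right _ _)
  rcases hs.eq_zero_or_exists_le with rfl | ⟨u, v, hu, hv, huv, hvu, rfl⟩
  · exact mem_insert _ _
  unfold _root_.fuse at h1 h2
  by_cases hvz : v < z
  · exact Or.inr (Or.inl ⟨u, ⟨hu, huv.trans_lt hvz⟩, v, ⟨hv, hvz⟩, rfl⟩)
  · have := hmin u ⟨hu, by change u < z; linarith⟩ (by linarith)
    linarith

theorem isPWO_fusibleNumbers : fusibleNumbers.IsPWO := by
  have hall : ∀ r, (fusibleNumbers ∩ Iio r).IsPWO := by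
    by_contra! hcon
    obtain ⟨b, hb⟩ := hcon
    set T : Set ℝ := {r | (fusibleNumbers ∩ Iio r).IsPWO} with hT
    have hdown : ∀ {r r'}, r ∈ T → r' ≤ r → r' ∈ T := fun hr hle =>
      IsPWO.mono hr (inter_subset_inter_right _ (Iio_subset_Iio hle))
    have hbdd : BddAbove T := ⟨b, fun r hr => le_of_not_gt fun hbr => hb (hdown hr hbr.le)⟩
    have h0 : (0 : ℝ) ∈ T := by
      refine isPWO_empty.mono ?_
      rintro x ⟨hx, hx0⟩
      exact absurd hx.nonneg (not_le.2 hx0)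
    have hz : sSup T ∈ T := isPWO_fusibleNumbers_inter_Iio_of_forall_lt fun r hr => by
      obtain ⟨r', hr', hlt⟩ := exists_lt_of_lt_csSup ⟨0, h0⟩ hr
      exact hdown hr' hlt.le
    obtain ⟨δ, hδ, h⟩ := exists_isPWO_fusibleNumbers_inter_Iio_add hz
    linarith [le_csSup hbdd h]
  rw [isPWO_iff_isWF, isWF_iff_no_descending_seq]
  intro f hf hmem
  have h1 := (hall (f 0)).isWF
  rw [isWF_iff_no_descending_seq] at h1
  exact h1 (fun n => f (n + 1)) (fun m n hmn => hf (by omega))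
    fun n => ⟨hmem _, hf (Nat.succ_pos n)⟩

instance : WellFoundedLT fusibleNumbers := ⟨isPWO_fusibleNumbers.isWF⟩

/-! ### The order type is at most `ε₀` -/

/-- The map `x ↦ x + 1` on fusible numbers. -/
def fusibleAddOne (x : fusibleNumbers) : fusibleNumbers := ⟨x + 1, x.2.add_one⟩

/-- The graph of `∼` on fusible numbers, as a ternary relation because `x ∼ y` need not be fusible
when `1 ≤ |y - x|`. -/
def FuseRel (x y z : fusibleNumbers) : Prop := (z : ℝ) = fuse x y

theorem FuseRel.mono (x y z x' y' z' : fusibleNumbers) (h : FuseRel x y z) (h' : FuseRel x' y' z')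
    (hx : x ≤ x') (hy : y ≤ y') : z ≤ z' := by
  rw [← Subtype.coe_le_coe] at hx hy ⊢
  rw [FuseRel, fuse] at h h'
  linarith

/-- A number `u ∼ v < x + 1 - 2⁻ᵏ⁻¹` with `u ≤ v` is less than `u + 1`, which deals with `u < x`; and
if `x ≤ u`, then `v` is at least twice as far from `x + 1` as `u ∼ v` is. -/
theorem Iio_sub_half_pow_subset (x : fusibleNumbers) (k : ℕ) :
    {s : fusibleNumbers | (s : ℝ) < x + 1 - (1 / 2) ^ (k + 1)} ⊆
      {⟨0, .zero⟩} ∪ (⋃ u ∈ Iio x, Iio (fusibleAddOne u)) ∪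
        relImage FuseRel {s : fusibleNumbers | (s : ℝ) < x + 1 - (1 / 2) ^ k}
          {s : fusibleNumbers | (s : ℝ) < x + 1 - (1 / 2) ^ k} := by
  rintro ⟨s, hs⟩ hsk
  change s < x + 1 - (1 / 2) ^ (k + 1) at hsk
  rcases hs.eq_zero_or_exists_le with rfl | ⟨u, v, hu, hv, huv, hvu, rfl⟩
  · exact Or.inl (Or.inl rfl)
  rw [pow_succ, fuse] at hsk
  by_cases hux : u < x
  · refine Or.inl (Or.inr (mem_iUnion₂.2 ⟨⟨u, hu⟩, hux, ?_⟩))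
    change fuse u v < u + 1
    unfold fuse
    linarith
  · exact Or.inr ⟨⟨u, hu⟩, by change u < x + 1 - (1 / 2) ^ k; linarith, ⟨v, hv⟩,
      by change v < x + 1 - (1 / 2) ^ k; linarith, rfl⟩

theorem exists_half_pow_lt {d : ℝ} (hd : 0 < d) : ∃ k : ℕ, (1 / 2 : ℝ) ^ k < d :=
  exists_pow_lt_of_lt_one hd (by norm_num)

/-- The tower of exponentials bounding the fusible numbers below `x + 1` in terms of those below `x`.
The summand `1` leaves room for the `x` whose `o x` is a limit: the predecessors of `x` only give the
non-strict bound `ω ^ ω ^ o x` for the fusible numbers below some `u + 1`, `u < x`. -/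
theorem typeLT_Iio_fusibleAddOne_le (x : fusibleNumbers) :
    typeLT (Iio (fusibleAddOne x)) ≤ ω ^ ω ^ (typeLT (Iio x) + 1) := by
  induction x using WellFoundedLT.induction with
  | _ x ih =>
  have hprev : typeLT ↥(⋃ u ∈ Iio x, Iio (fusibleAddOne u)) < ω ^ ω ^ (typeLT (Iio x) + 1) := by
    have hle : typeLT ↥(⋃ u ∈ Iio x, Iio (fusibleAddOne u)) ≤ ω ^ ω ^ typeLT (Iio x) := by
      refine typeLT_le_of_forall_lt fun s hs => ?_
      obtain ⟨u, hu, hsu⟩ := mem_iUnion₂.1 hs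
      calc _ ≤ typeLT (Iio s) := type_mono inter_subset_right
        _ < typeLT (Iio (fusibleAddOne u)) := (typein_lt_typein (α := fusibleNumbers) (· < ·)).2 hsu
        _ ≤ ω ^ ω ^ (typeLT (Iio u) + 1) := ih u hu
        _ ≤ ω ^ ω ^ typeLT (Iio x) := by
          gcongr
          · exact omega0_pos
          · exact omega0_pos
          · exact Order.add_one_le_of_lt ((typein_lt_typein (α := fusibleNumbers) (· < ·)).2 hu)
    refine hle.trans_lt ?_
    rw [opow_lt_opow_iff_right one_lt_omega0, opow_lt_opow_iff_right one_lt_omega0]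
    exact lt_add_one _
  have hk : ∀ k : ℕ, typeLT {s : fusibleNumbers | (s : ℝ) < x + 1 - (1 / 2) ^ k} <
      ω ^ ω ^ (typeLT (Iio x) + 1) := by
    intro k
    induction k with
    | zero =>
      have h : {s : fusibleNumbers | (s : ℝ) < x + 1 - (1 / 2) ^ 0} = Iio x := by
        ext s
        simp
      rw [h]
      calc typeLT (Iio x) < typeLT (Iio x) + 1 := lt_add_one _
        _ ≤ ω ^ (typeLT (Iio x) + 1) := right_le_opow _ one_lt_omega0
        _ ≤ _ := right_le_opow _ one_lt_omega0
    | succ k ihk =>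
      refine (type_mono (Iio_sub_half_pow_subset x k)).trans_lt
        (typeLT_union_lt_opow (typeLT_union_lt_opow ?_ hprev)
          (typeLT_relImage_lt FuseRel.mono (by simp) ihk ihk))
      rw [type_eq_one_of_unique, ← opow_zero ω, opow_lt_opow_iff_right one_lt_omega0]
      exact opow_pos _ omega0_pos
  refine typeLT_le_of_forall_lt fun s hs => ?_
  have hs' : (s : ℝ) < x + 1 := hs
  obtain ⟨k, hk'⟩ := exists_half_pow_lt (sub_pos.2 hs')
  refine (type_mono ?_).trans_lt (hk k)
  rintro r ⟨-, hr⟩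
  have hr' : (r : ℝ) < s := hr
  change (r : ℝ) < x + 1 - (1 / 2) ^ k
  linarith

/-- Every proper initial segment of the fusible numbers is shorter than `ε₀`; it is enough to look at
the natural numbers, which are fusible and cofinal. -/
theorem typeLT_Iio_lt_epsilon_zero (x : fusibleNumbers) : typeLT (Iio x) < ε₀ := by
  have hopow : ∀ o : Ordinal.{0}, o < ε₀ → ω ^ o < ε₀ := fun o ho => by
    rw [← omega0_opow_epsilon 0]
    exact (opow_lt_opow_iff_right one_lt_omega0).2 ho
  have hnat : ∀ (n : ℕ), ∃ h : IsFusible n, typeLT (Iio (⟨n, h⟩ : fusibleNumbers)) < ε₀ := by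
    intro n
    induction n with
    | zero =>
      have h0 : IsFusible (0 : ℕ) := by simpa using IsFusible.zero
      refine ⟨h0, ?_⟩
      have hempty : Iio (⟨(0 : ℕ), h0⟩ : fusibleNumbers) = ∅ := by
        refine eq_empty_of_forall_notMem fun s hs => ?_
        have hs' : (s : ℝ) < (0 : ℕ) := hs
        rw [Nat.cast_zero] at hs'
        exact absurd s.2.nonneg (not_le.2 hs')
      rw [hempty, type_eq_zero_of_empty]
      exact epsilon_pos 0
    | succ n ih =>
      obtain ⟨h, ih⟩ := ih
      have h1 : IsFusible (n + 1 : ℕ) := by exact_mod_cast h.add_one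
      refine ⟨h1, ?_⟩
      have heq : (⟨(n + 1 : ℕ), h1⟩ : fusibleNumbers) = fusibleAddOne ⟨n, h⟩ :=
        Subtype.ext (Nat.cast_succ n)
      rw [heq]
      refine (typeLT_Iio_fusibleAddOne_le _).trans_lt (hopow _ (hopow _ ?_))
      rw [← omega0_opow_epsilon 0] at ih ⊢
      exact isPrincipal_add_omega0_opow _ ih (one_lt_opow.2 ⟨one_lt_omega0, (epsilon_pos 0).ne'⟩)
  obtain ⟨n, hn⟩ := exists_nat_gt (x : ℝ)
  obtain ⟨h, hlt⟩ := hnat n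
  exact (type_mono (Iio_subset_Iio (show x ≤ ⟨n, h⟩ from hn.le))).trans_lt hlt

/-! ### The order type is at least `ε₀` -/

/-- The `k`-th iterate of `s ↦ x ∼ s` preserves fusibility on `[x, x + 1)`: it is the contraction
towards `x + 1` by the factor `2⁻ᵏ`. -/
theorem IsFusible.add_one_sub_mul_half_pow {x s : ℝ} (hx : IsFusible x) (hs : IsFusible s)
    (hxs : x ≤ s) (hsx : s < x + 1) (k : ℕ) : IsFusible (x + 1 - (x + 1 - s) * (1 / 2) ^ k) := by
  induction k with
  | zero => simpa using hs
  | succ k ih =>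
    have hpos : (0 : ℝ) < (1 / 2) ^ k := by positivity
    have hle : (1 / 2 : ℝ) ^ k ≤ 1 := pow_le_one₀ (by norm_num) (by norm_num)
    have := IsFusible.fuse hx ih (by rw [abs_lt]; constructor <;> nlinarith)
    convert this using 1
    unfold _root_.fuse
    ring

theorem IsFusible.exists_sub_one_lt {x : ℝ} (hx : IsFusible x) (h0 : x ≠ 0) :
    ∃ y, IsFusible y ∧ x - 1 < y ∧ y < x := by
  rcases hx.eq_zero_or_exists_le with rfl | ⟨u, v, hu, hv, huv, hvu, rfl⟩
  · exact absurd rfl h0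
  · exact ⟨v, hv, by unfold _root_.fuse; linarith, by unfold _root_.fuse; linarith⟩

/-- Arbitrarily close to `x + 1`, on its left, the fusible numbers have order type at least `ω ^ o`,
where `o` is the order type of the fusible numbers below `x`. -/
theorem opow_le_typeLT_Ico (x : fusibleNumbers) :
    ∀ t : ℝ, t < x + 1 →
      ω ^ typeLT (Iio x) ≤ typeLT {s : fusibleNumbers | t ≤ s ∧ (s : ℝ) < x + 1} := by
  induction x using WellFoundedLT.induction with
  | _ x ih =>
  intro t ht
  rcases eq_or_ne (typeLT (Iio x)) 0 with h0 | h0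
  · rw [h0, opow_zero, one_le_iff_ne_zero, type_ne_zero_iff_nonempty]
    obtain ⟨k, hk⟩ := exists_half_pow_lt (sub_pos.2 ht)
    have hpos : (0 : ℝ) < (1 / 2) ^ k := by positivity
    refine ⟨⟨⟨_, x.2.add_one_sub_mul_half_pow x.2 le_rfl (by linarith) k⟩, ?_, ?_⟩⟩
    · change t ≤ x + 1 - (x + 1 - x) * (1 / 2 : ℝ) ^ k
      linarith
    · change x + 1 - (x + 1 - x) * (1 / 2 : ℝ) ^ k < x + 1
      linarith
  refine le_of_forall_lt fun c hc => ?_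
  obtain ⟨a, ha, n, hn⟩ := (lt_omega0_opow h0).1 hc
  refine hn.trans_le ?_
  clear hn hc
  -- Enlarging `y` keeps `a ≤ o y`, so `y` may be taken within distance `1` of `x`.
  obtain ⟨y, hyx, hya, hy1⟩ : ∃ y < x, a ≤ typeLT (Iio y) ∧ (x : ℝ) < y + 1 := by
    obtain ⟨y, hyx, hya⟩ := exists_typeLT_inter_Iio_eq ha
    have hyx' : (y : ℝ) < x := hyx
    have hx0 : (x : ℝ) ≠ 0 := (y.2.nonneg.trans_lt hyx').ne'
    obtain ⟨w, hw, hxw, hwx⟩ := x.2.exists_sub_one_lt hx0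
    refine ⟨max y ⟨w, hw⟩, max_lt hyx hwx, ?_, ?_⟩
    · rw [← hya]
      refine type_mono fun s hs => ?_
      exact lt_of_lt_of_le (mem_Iio.1 hs.2) (le_max_left _ _)
    · have : w ≤ (max y ⟨w, hw⟩ : fusibleNumbers) :=
        Subtype.coe_le_coe.2 (le_max_right y ⟨w, hw⟩)
      linarith
  have hyx' : (y : ℝ) < x := hyx
  -- A copy of the fusible numbers in `[x, y + 1)` fits between `t` and some `t' < x + 1`.
  have step : ∀ t : ℝ, t < x + 1 → ∃ t', t ≤ t' ∧ t' < x + 1 ∧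
      ω ^ a ≤ typeLT {s : fusibleNumbers | t ≤ s ∧ (s : ℝ) < t'} := by
    intro t ht
    obtain ⟨k, hk⟩ := exists_half_pow_lt (sub_pos.2 ht)
    have hpos : (0 : ℝ) < (1 / 2) ^ k := by positivity
    have hmem : ∀ s : fusibleNumbers, (x : ℝ) ≤ s ∧ (s : ℝ) < y + 1 →
        IsFusible (x + 1 - (x + 1 - s) * (1 / 2) ^ k) := fun s hs =>
      x.2.add_one_sub_mul_half_pow s.2 hs.1 (by linarith [hs.2]) k
    refine ⟨x + 1 - (x - y) * (1 / 2) ^ k, by nlinarith, by nlinarith, ?_⟩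
    calc ω ^ a ≤ ω ^ typeLT (Iio y) := opow_le_opow_right omega0_pos hya
      _ ≤ typeLT {s : fusibleNumbers | (x : ℝ) ≤ s ∧ (s : ℝ) < y + 1} := ih y hyx x hy1
      _ ≤ _ := by
        classical
        refine typeLT_le_of_strictMonoOn (fun s : fusibleNumbers =>
          if h : (x : ℝ) ≤ s ∧ (s : ℝ) < y + 1 then
            (⟨x + 1 - (x + 1 - s) * (1 / 2) ^ k, hmem s h⟩ : fusibleNumbers) else s) ?_ ?_
        · intro s hs r hr hsr
          have hsr' : (s : ℝ) < r := hsr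
          simp only [mem_ofPred_eq] at hs hr
          simp only [dif_pos hs, dif_pos hr]
          rw [← Subtype.coe_lt_coe]
          dsimp only
          nlinarith
        · intro s hs
          simp only [mem_ofPred_eq] at hs
          simp only [dif_pos hs, mem_ofPred_eq]
          constructor <;> nlinarith
  induction n generalizing t with
  | zero => simp
  | succ n ihn =>
    obtain ⟨t', htt', ht', hle⟩ := step t ht
    have hunion : {s : fusibleNumbers | t ≤ s ∧ (s : ℝ) < t'} ∪
        {s : fusibleNumbers | t' ≤ s ∧ (s : ℝ) < x + 1} ⊆
        {s : fusibleNumbers | t ≤ s ∧ (s : ℝ) < x + 1} := by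
      rintro s (⟨h1, h2⟩ | ⟨h1, h2⟩)
      · exact ⟨h1, h2.trans ht'⟩
      · exact ⟨htt'.trans h1, h2⟩
    calc ω ^ a * (n + 1 : ℕ) = ω ^ a + ω ^ a * n := by
          rw [add_comm, Nat.cast_add, Nat.cast_one, mul_one_add]
      _ ≤ _ := add_le_add hle (ihn t' ht')
      _ = _ := (typeLT_union_of_lt fun s hs r hr =>
          Subtype.coe_lt_coe.1 (lt_of_lt_of_le hs.2 hr.1)).symm
      _ ≤ _ := type_mono hunion

theorem opow_typeLT_fusibleNumbers_le : ω ^ typeLT fusibleNumbers ≤ typeLT fusibleNumbers := by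
  have hsucc : ∀ x : fusibleNumbers, ω ^ typeLT (Iio x) < typeLT fusibleNumbers := fun x => by
    refine lt_of_le_of_lt ?_ (typein_lt_type (α := fusibleNumbers) (· < ·) (fusibleAddOne x))
    exact (opow_le_typeLT_Ico x 0 (by linarith [x.2.nonneg])).trans (type_mono fun s hs => hs.2)
  have hsurj : ∀ o < typeLT fusibleNumbers, ∃ x : fusibleNumbers, typeLT (Iio x) = o :=
    fun o ho => typein_surj (α := fusibleNumbers) (· < ·) ho
  have hlim : IsSuccLimit (typeLT fusibleNumbers) := by
    have : NoMaxOrder fusibleNumbers :=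
      ⟨fun x => ⟨fusibleAddOne x, Subtype.coe_lt_coe.1 (lt_add_one (x : ℝ))⟩⟩
    refine Ordinal.isSuccLimit_iff.2 ⟨?_, isSuccPrelimit_type_lt⟩
    rw [type_ne_zero_iff_nonempty]
    exact ⟨⟨0, .zero⟩⟩
  rw [opow_le_of_isSuccLimit omega0_ne_zero hlim]
  intro o ho
  obtain ⟨x, rfl⟩ := hsurj o ho
  exact (hsucc x).le

end Fusible

theorem theorem1 :
    ∃ _ : IsWellOrder fusibleNumbers (· < ·),
      Ordinal.type (fun x y : fusibleNumbers => x < y) = ε₀ := by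
  refine ⟨inferInstance, le_antisymm ?_
    (Ordinal.epsilon_zero_le_of_omega0_opow_le opow_typeLT_fusibleNumbers_le)⟩
  by_contra! hlt
  obtain ⟨x, hx⟩ := Ordinal.typein_surj (α := fusibleNumbers) (· < ·) hlt
  exact (typeLT_Iio_lt_epsilon_zero x).ne hx
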